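/- Let $\mathbb{T}=(\mathbb{R}\cup\{-\infty\},\oplus,\otimes)$ be the max-plus semifield, with $a\oplus b=\max\{a,b\}$, $a\otimes b=a+b$ and $\varepsilon=-\infty$; let $A^{(m)}$ and $\lambda^{(m)}$ denote max-plus powers, and write $\varepsilon$ also for the vector all of whose entries are $-\infty$. A vector $x\in\mathbb{T}^n\setminus\{\varepsilon\}$ is called a generalised eigenvector of $A\in M_n(\mathbb{T})$ corresponding to the eigenvalue $\lambda\in\mathbb{T}$ if $A^{(m)}\otimes x=\lambda^{(m)}\otimes x$ for some integer $m\ge 1$. Let $n\ge 1$ and let $A,B\in M_n(\mathbb{T})$ commute, that is, $A\otimes B=B\otimes A$. Then $A$ and $B$ have a common generalised eigenvector: there are $x\in\mathbb{T}^n\setminus\{\varepsilon\}$ and $\lambda,\mu\in\mathbb{T}$ such that $x$ is a generalised eigenvector of $A$ corresponding to $\lambda$ and a generalised eigenvector of $B$ corresponding to $\mu$. Moreover, $\lambda$ is a real number if no column of $A$ is identically $\varepsilon$ (for instance, if $A$ is irreducible and is not the $1\times 1$ matrix $(\varepsilon)$), and $\mu$ is a real number if no column of $B$ is identically $\varepsilon$.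 -/

import Mathlib

/-- The max-plus semifield `𝕋 = ℝ ∪ {-∞}`, with `a ⊕ b = max a b` and `a ⊗ b = a + b`.
`Tropical` takes minima and uses a top element, hence the order dual: the adjoined top element
of `ℝᵒᵈ` is `-∞`. In semiring notation, `0 : MaxPlus` is `ε = -∞` and `1 : MaxPlus` is the real
number `0`; `+`, `*` and `^` are `⊕`, `⊗` and the max-plus power. -/
abbrev MaxPlus : Type := Tropical (WithTop ℝᵒᵈ)

namespace MaxPlus

/-- The element of `𝕋` given by a real number. -/
def ofReal (a : ℝ) : MaxPlus := Tropical.trop ((OrderDual.toDual a : ℝᵒᵈ) : WithTop ℝᵒᵈ)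

theorem ofReal_add_ofReal (a b : ℝ) : ofReal a + ofReal b = ofReal (max a b) := by
  change Tropical.trop (min ((OrderDual.toDual a : ℝᵒᵈ) : WithTop ℝᵒᵈ) ((OrderDual.toDual b : ℝᵒᵈ) : WithTop ℝᵒᵈ)) = _
  rw [← WithTop.coe_min]
  rfl

theorem ofReal_mul_ofReal (a b : ℝ) : ofReal a * ofReal b = ofReal (a + b) := rfl

theorem ofReal_zero : ofReal 0 = 1 := rfl

theorem eq_zero_or_eq_ofReal (a : MaxPlus) : a = 0 ∨ ∃ r : ℝ, a = ofReal r := by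
  rcases h : Tropical.untrop a with _ | r
  · exact Or.inl (Tropical.untrop_injective h)
  · exact Or.inr ⟨OrderDual.ofDual r, Tropical.untrop_injective h⟩

theorem ofReal_ne_zero (a : ℝ) : ofReal a ≠ 0 := fun h =>
  WithTop.coe_ne_top (Tropical.trop_injective h)

theorem ofReal_injective : Function.Injective ofReal := fun _ _ h =>
  OrderDual.toDual.injective (WithTop.coe_injective (Tropical.trop_injective h))

/-- `x` is a generalised eigenvector of the max-plus matrix `A`, corresponding to the
eigenvalue `lam ∈ 𝕋`: it is not the vector `ε`, and `A^(m) ⊗ x = lam^(m) ⊗ x` for some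
`m ≥ 1`. (The least such `m` is its order; eigenvectors are those of order `1`.) -/
def IsGeneralisedEigenvector {n : ℕ} (A : Matrix (Fin n) (Fin n) MaxPlus) (lam : MaxPlus)
    (x : Fin n → MaxPlus) : Prop :=
  x ≠ 0 ∧ ∃ m : ℕ, 1 ≤ m ∧ (A ^ m).mulVec x = lam ^ m • x

end MaxPlus

/-!
The order that `Tropical` puts on `MaxPlus` is opposite to the order of weights: `a ≤ b` says that
`a` is the max-plus larger element, `0 = ε` is the greatest element, and a sum is the minimum of its
terms. It is therefore convenient to regard an entry as a *cost*. The entry `(A ^ k) i j` is the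
least cost of a walk of length `k` from `i` to `j`, and cost `ofReal r` is smaller when `r` is larger.

The theorem is obtained from a spectral projector. If `A` is not nilpotent, there are `m ≥ 1`,
`c ≠ 0` and an idempotent `Q ≠ 0` that commutes with everything commuting with `A`, such that
`A ^ m * Q = c • Q` (`exists_spectral_projector`). Granted this, let `B` commute with `A`. If
`B * Q` is nilpotent, a power of `B` kills the columns of `Q`, which are generalised eigenvectors of
`A`. Otherwise `B * Q` has a projector `P` of its own; its columns lie in the image of `Q`, on which
`B` and `B * Q` agree, so that they are generalised eigenvectors of `A` and of `B`
(`exists_common_eigenmatrix`). If `A` is nilpotent, one of its powers kills every vector, and only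
`B` matters.

To construct `Q`, divide `A` by its maximal cycle mean, so that no cycle has cost below `1` and some
cycles, the critical ones, have cost exactly `1`; then pass to the power `D` of exponent `N!`, where
`N` is the number of indices, which turns the nodes of critical cycles into the nodes `c` with
`D c c = 1`. The walks of length `k` through a critical node have a least cost that does not depend
on `k` once `k ≥ 2 * N`; those costs are the entries of `Q` (`criticalPart`). The walks that avoid
critical nodes are governed by the powers of a matrix `R` (`noncriticalPart`) all of whose cycles
have cost greater than `1`, so that the entries of `R ^ k` tend to `ε`. Thus `D ^ k = Q + R ^ k`
for large `k`, and `Q` is the limit of the powers of `D`. Letting `k` grow in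
`B * D ^ k = D ^ k * B` and `D ^ k * Q = Q` shows that `Q` commutes with `B` and is idempotent.
-/

namespace MaxPlus

open Finset

/-! ### Order and finite sums -/

theorem ofReal_le_ofReal {a b : ℝ} : ofReal a ≤ ofReal b ↔ b ≤ a := by
  change (WithTop.some (OrderDual.toDual a) : WithTop ℝᵒᵈ) ≤ WithTop.some (OrderDual.toDual b) ↔ _
  rw [WithTop.coe_le_coe, OrderDual.toDual_le_toDual]

theorem ofReal_lt_ofReal {a b : ℝ} : ofReal a < ofReal b ↔ b < a := by
  rw [lt_iff_not_ge, ofReal_le_ofReal, not_le]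

theorem ofReal_pow (a : ℝ) (k : ℕ) : ofReal a ^ k = ofReal (k * a) := by
  induction k with
  | zero => simp [ofReal_zero]
  | succ k ih => rw [pow_succ, ih, ofReal_mul_ofReal]; push_cast; ring_nf

theorem lt_zero_iff {a : MaxPlus} : a < 0 ↔ a ≠ 0 := (Tropical.le_zero a).lt_iff_ne

theorem le_add_iff {a b c : MaxPlus} : c ≤ a + b ↔ c ≤ a ∧ c ≤ b :=
  le_min_iff

theorem ne_zero_of_le {a b : MaxPlus} (h : a ≤ b) (hb : b ≠ 0) : a ≠ 0 := by
  rintro rfl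
  exact hb (le_antisymm (Tropical.le_zero b) h)

theorem le_sum_iff {κ : Type*} {s : Finset κ} {f : κ → MaxPlus} {c : MaxPlus} :
    c ≤ ∑ i ∈ s, f i ↔ ∀ i ∈ s, c ≤ f i := by
  classical
  induction s using Finset.induction_on with
  | empty => simp
  | insert a s ha ih => simp [Finset.sum_insert ha, le_add_iff, ih]

theorem sum_le {κ : Type*} {s : Finset κ} {f : κ → MaxPlus} {i : κ} (hi : i ∈ s) :
    ∑ i ∈ s, f i ≤ f i :=
  le_sum_iff.1 le_rfl i hi

theorem exists_le_sum {κ : Type*} {s : Finset κ} (hs : s.Nonempty) (f : κ → MaxPlus) :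
    ∃ i ∈ s, f i ≤ ∑ i ∈ s, f i := by
  obtain ⟨i, hi, h⟩ := s.exists_min_image f hs
  exact ⟨i, hi, le_sum_iff.2 h⟩

variable {ι : Type*} [Fintype ι]

theorem le_mul_apply_iff {A B : Matrix ι ι MaxPlus} {i j : ι} {c : MaxPlus} :
    c ≤ (A * B) i j ↔ ∀ l, c ≤ A i l * B l j := by
  simp [Matrix.mul_apply, le_sum_iff]

theorem mul_apply_le (A B : Matrix ι ι MaxPlus) (i l j : ι) : (A * B) i j ≤ A i l * B l j :=
  le_mul_apply_iff.1 le_rfl l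

theorem exists_le_mul_apply (A B : Matrix ι ι MaxPlus) (i j : ι) :
    ∃ l, A i l * B l j ≤ (A * B) i j := by
  obtain ⟨l, -, h⟩ := exists_le_sum (s := univ) ⟨i, mem_univ i⟩ fun l => A i l * B l j
  exact ⟨l, by rwa [Matrix.mul_apply]⟩

/-! ### Walks and cycles -/

variable [DecidableEq ι]

theorem pow_apply_le_prod (A : Matrix ι ι MaxPlus) (p : ℕ → ι) (k : ℕ) :
    (A ^ k) (p 0) (p k) ≤ ∏ t ∈ range k, A (p t) (p (t + 1)) := by
  induction k with
  | zero => simp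
  | succ k ih =>
    rw [pow_succ, prod_range_succ]
    exact (mul_apply_le _ _ _ (p k) _).trans (mul_le_mul_left ih _)

/-- An entry of `A ^ k` other than `ε` is attained by a walk. -/
theorem exists_prod_le_pow_apply (A : Matrix ι ι MaxPlus) (i : ι) (k : ℕ) (j : ι)
    (h : (A ^ k) i j ≠ 0) :
    ∃ p : ℕ → ι, p 0 = i ∧ p k = j ∧ ∏ t ∈ range k, A (p t) (p (t + 1)) ≤ (A ^ k) i j := by
  induction k generalizing j with
  | zero =>
    have hij : i = j := by
      by_contra hij
      exact h (by simp [hij])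
    exact ⟨fun _ => i, rfl, hij, by simp [hij]⟩
  | succ k ih =>
    rw [pow_succ] at h ⊢
    obtain ⟨l, hl⟩ := exists_le_mul_apply (A ^ k) A i j
    obtain ⟨p, h0, hk, hp⟩ := ih l (left_ne_zero_of_mul (ne_zero_of_le hl h))
    refine ⟨Function.update p (k + 1) j, ?_, ?_, le_trans ?_ hl⟩
    · rw [Function.update_of_ne (by omega), h0]
    · simp
    · rw [prod_range_succ, Function.update_of_ne (by omega), Function.update_self, hk]
      refine mul_le_mul_left (le_trans (le_of_eq ?_) hp) _
      refine prod_congr rfl fun t ht => ?_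
      have := mem_range.1 ht
      rw [Function.update_of_ne (by omega), Function.update_of_ne (by omega)]

/-- A walk with at least as many steps as there are nodes contains a cycle; removing the cycle leaves
a walk between the same end points. -/
theorem exists_cycle_mul_le (A : Matrix ι ι MaxPlus) {k : ℕ} (hk : Fintype.card ι ≤ k) (i j : ι) :
    ∃ v b, 1 ≤ b ∧ b ≤ Fintype.card ι ∧ (A ^ b) v v * (A ^ (k - b)) i j ≤ (A ^ k) i j := by
  by_cases h : (A ^ k) i j = 0
  · exact ⟨i, 1, le_rfl, Fintype.card_pos_iff.2 ⟨i⟩, h ▸ Tropical.le_zero _⟩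
  obtain ⟨p, rfl, rfl, hp⟩ := exists_prod_le_pow_apply A i k j h
  obtain ⟨s, t, hst, htc, hv⟩ : ∃ s t, s < t ∧ t ≤ Fintype.card ι ∧ p s = p t := by
    obtain ⟨s, hs, t, ht, hne, he⟩ := exists_ne_map_eq_of_card_lt_of_maps_to
      (s := range (Fintype.card ι + 1)) (t := univ) (f := p) (by simp) (by simp)
    have := mem_range.1 hs
    have := mem_range.1 ht
    rcases lt_or_gt_of_ne hne with h | h
    · exact ⟨s, t, h, by omega, he⟩
    · exact ⟨t, s, h, by omega, he.symm⟩
  obtain ⟨b, rfl⟩ := Nat.exists_eq_add_of_lt hst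
  obtain ⟨r, rfl⟩ := Nat.exists_eq_add_of_le (htc.trans hk)
  refine ⟨p s, b + 1, by omega, by omega, le_trans ?_ hp⟩
  have h1 := pow_apply_le_prod A p s
  have h2 := pow_apply_le_prod A (fun t => p (s + t)) (b + 1)
  have h3 := pow_apply_le_prod A (fun t => p (s + b + 1 + t)) r
  have e : s + b + 1 + r - (b + 1) = s + r := by omega
  rw [e, pow_add A s r, prod_range_add, add_assoc s b 1, prod_range_add,
    mul_comm (∏ t ∈ range s, _), mul_assoc]
  refine mul_le_mul' ?_ ((mul_apply_le _ _ _ (p s) _).trans (mul_le_mul' h1 ?_))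
  · simpa [← add_assoc, ← hv] using h2
  · simpa [← add_assoc, ← hv] using h3

/-- Either there are no cycles, or there is a maximal cycle mean `r` over the cycles whose length is
at most the number of nodes. -/
theorem exists_cycleMean (A : Matrix ι ι MaxPlus) :
    (∀ v b, 1 ≤ b → b ≤ Fintype.card ι → (A ^ b) v v = 0) ∨
    ∃ r : ℝ, (∀ v b, 1 ≤ b → b ≤ Fintype.card ι → ofReal r ^ b ≤ (A ^ b) v v) ∧
      ∃ v b, 1 ≤ b ∧ b ≤ Fintype.card ι ∧ (A ^ b) v v = ofReal r ^ b := by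
  refine or_iff_not_imp_left.2 fun h => ?_
  push Not at h
  obtain ⟨v₀, b₀, h1, h2, h3⟩ := h
  have key : ∀ q : ι × ℕ, ∃ r : ℝ, (A ^ q.2) q.1 q.1 ≠ 0 → (A ^ q.2) q.1 q.1 = ofReal r := by
    intro q
    rcases eq_zero_or_eq_ofReal ((A ^ q.2) q.1 q.1) with h | ⟨r, h⟩
    · exact ⟨0, fun h' => absurd h h'⟩
    · exact ⟨r, fun _ => h⟩
  choose w hw using key
  -- The weight of a closed walk of length `b`, divided by `b`, is maximised over those not `ε`.
  obtain ⟨⟨v, b⟩, hq, hmax⟩ := exists_max_image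
    ((univ ×ˢ Icc 1 (Fintype.card ι)).filter fun q : ι × ℕ => (A ^ q.2) q.1 q.1 ≠ 0)
    (fun q => w q / q.2) ⟨(v₀, b₀), by simp [h1, h2, h3]⟩
  simp only [mem_filter, mem_product, mem_univ, mem_Icc, true_and] at hq hmax
  refine ⟨w (v, b) / b, fun u c hc hc' => ?_, v, b, hq.1.1, hq.1.2, ?_⟩
  · by_cases h0 : (A ^ c) u u = 0
    · exact h0 ▸ Tropical.le_zero _
    have hc0 : (0 : ℝ) < c := by exact_mod_cast hc
    have := hmax (u, c) ⟨⟨hc, hc'⟩, h0⟩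
    rw [hw (u, c) h0, ofReal_pow, ofReal_le_ofReal]
    rw [div_le_iff₀ hc0] at this
    linarith
  · have hb0 : (b : ℝ) ≠ 0 := by have := hq.1.1; positivity
    rw [hw (v, b) hq.2, ofReal_pow]
    congr 1
    field_simp

/-- If short cycles have mean at most `r`, then the costs of all walks of length `k` are bounded
below by that of `k` steps of weight `r`, up to a constant. -/
theorem exists_pow_mul_le (A : Matrix ι ι MaxPlus) {r : ℝ}
    (h : ∀ v b, 1 ≤ b → b ≤ Fintype.card ι → ofReal r ^ b ≤ (A ^ b) v v) :
    ∃ M, M ≠ 0 ∧ ∀ k i j, ofReal r ^ k * M ≤ (A ^ k) i j := by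
  -- The summand `1` keeps `N` different from `ε` when all the entries involved are `ε`.
  let N := 1 + ∑ k ∈ range (Fintype.card ι), ∑ i, ∑ j, ofReal (-r) ^ k * (A ^ k) i j
  refine ⟨N, ne_zero_of_le (b := 1) ?_ one_ne_zero, fun k => ?_⟩
  · exact (le_add_iff.1 le_rfl).1
  induction k using Nat.strong_induction_on with
  | _ k ih =>
    intro i j
    rcases lt_or_ge k (Fintype.card ι) with hk | hk
    · have hN : N ≤ ofReal (-r) ^ k * (A ^ k) i j := by
        exact (le_add_iff.1 (le_refl N)).2.trans <| (sum_le (mem_range.2 hk)).trans <|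
          (sum_le (mem_univ i)).trans (sum_le (mem_univ j))
      refine (mul_le_mul_right hN _).trans_eq ?_
      rw [← mul_assoc, ← mul_pow, ofReal_mul_ofReal, add_neg_cancel, ofReal_zero, one_pow, one_mul]
    · obtain ⟨v, b, h1, h2, h3⟩ := exists_cycle_mul_le A hk i j
      refine le_trans ?_ h3
      have : ofReal r ^ k * N = ofReal r ^ b * (ofReal r ^ (k - b) * N) := by
        rw [← mul_assoc, ← pow_add]
        congr 2
        omega
      rw [this]
      exact mul_le_mul' (h v b h1 h2) (ih (k - b) (by omega) i j)

/-- If every short cycle has negative weight, the entries of `A ^ k` tend to `ε`. -/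
theorem exists_lt_pow_apply (A : Matrix ι ι MaxPlus)
    (h : ∀ v b, 1 ≤ b → b ≤ Fintype.card ι → 1 < (A ^ b) v v) {t : MaxPlus} (ht : t ≠ 0) :
    ∃ K, ∀ k ≥ K, ∀ i j, t < (A ^ k) i j := by
  obtain ⟨r, hr, hA⟩ : ∃ r : ℝ, r < 0 ∧
      ∀ v b, 1 ≤ b → b ≤ Fintype.card ι → ofReal r ^ b ≤ (A ^ b) v v := by
    rcases exists_cycleMean A with h0 | ⟨r, hr, v, b, h1, h2, h3⟩
    · exact ⟨-1, by norm_num, fun v b h1 h2 => h0 v b h1 h2 ▸ Tropical.le_zero _⟩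
    · refine ⟨r, ?_, hr⟩
      have := h v b h1 h2
      rw [h3, ofReal_pow, ← ofReal_zero, ofReal_lt_ofReal] at this
      have hb : (0 : ℝ) < b := by exact_mod_cast h1
      nlinarith
  obtain ⟨M, hM, hle⟩ := exists_pow_mul_le A hA
  obtain ⟨m, rfl⟩ := (eq_zero_or_eq_ofReal M).resolve_left hM
  obtain ⟨t, rfl⟩ := (eq_zero_or_eq_ofReal t).resolve_left ht
  obtain ⟨K, hK⟩ := exists_nat_gt ((m - t) / -r)
  refine ⟨K, fun k hk i j => lt_of_lt_of_le ?_ (hle k i j)⟩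
  rw [ofReal_pow, ofReal_mul_ofReal, ofReal_lt_ofReal]
  rw [div_lt_iff₀ (by linarith)] at hK
  have : (K : ℝ) ≤ k := by exact_mod_cast hk
  nlinarith

/-- If every short cycle of `A` has negative weight, the entries of `B * A ^ k` and of `A ^ k * B`
tend to `ε`. -/
theorem exists_lt_mul_pow_apply (A B : Matrix ι ι MaxPlus)
    (h : ∀ v b, 1 ≤ b → b ≤ Fintype.card ι → 1 < (A ^ b) v v) {t : MaxPlus} (ht : t ≠ 0) :
    ∃ K, ∀ k ≥ K, ∀ i j, t < (B * A ^ k) i j ∧ t < (A ^ k * B) i j := by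
  obtain ⟨t, rfl⟩ := (eq_zero_or_eq_ofReal t).resolve_left ht
  have hN : (1 + ∑ i, ∑ j, B i j : MaxPlus) ≠ 0 :=
    ne_zero_of_le (b := 1) (le_add_iff.1 le_rfl).1 one_ne_zero
  obtain ⟨s, hs⟩ := (eq_zero_or_eq_ofReal _).resolve_left hN
  have hB : ∀ i j, ofReal s ≤ B i j := fun i j => by
    rw [← hs]
    exact (le_add_iff.1 le_rfl).2.trans <| (sum_le (mem_univ i)).trans (sum_le (mem_univ j))
  obtain ⟨K, hK⟩ := exists_lt_pow_apply A h (ofReal_ne_zero (t - s - 1))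
  have hlt : ofReal t < ofReal s * ofReal (t - s - 1) := by
    rw [ofReal_mul_ofReal, ofReal_lt_ofReal]
    linarith
  refine ⟨K, fun k hk i j => ⟨hlt.trans_le ?_, hlt.trans_le ?_⟩⟩
  · exact le_mul_apply_iff.2 fun l => mul_le_mul' (hB _ _) (hK k hk _ _).le
  · rw [mul_comm]
    exact le_mul_apply_iff.2 fun l => mul_le_mul' (hK k hk _ _).le (hB _ _)

theorem one_le_pow_apply_self {A : Matrix ι ι MaxPlus}
    (h : ∀ v b, 1 ≤ b → b ≤ Fintype.card ι → 1 ≤ (A ^ b) v v) (k : ℕ) (v : ι) :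
    1 ≤ (A ^ k) v v := by
  induction k using Nat.strong_induction_on with
  | _ k ih =>
    rcases Nat.eq_zero_or_pos k with rfl | hk0
    · simp
    rcases le_or_gt k (Fintype.card ι) with hk | hk
    · exact h v k hk0 hk
    · obtain ⟨u, b, h1, h2, h3⟩ := exists_cycle_mul_le A hk.le v v
      exact (one_le_mul (h u b h1 h2) (ih _ (by omega))).trans h3

/-- If no short cycle has cost below `1`, a node on a closed walk of cost `1` lies on a short one:
the cycles cut out of the walk cost at least `1`, so the cost stays `1`. -/
theorem exists_short_critical_cycle {A : Matrix ι ι MaxPlus}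
    (h : ∀ v b, 1 ≤ b → b ≤ Fintype.card ι → 1 ≤ (A ^ b) v v) (k : ℕ) (v : ι) (hk0 : 1 ≤ k)
    (hkv : (A ^ k) v v = 1) :
    ∃ b, 1 ≤ b ∧ b ≤ Fintype.card ι ∧ (A ^ b) v v = 1 := by
  induction k using Nat.strong_induction_on with
  | _ k ih =>
    rcases le_or_gt k (Fintype.card ι) with hk | hk
    · exact ⟨k, hk0, hk, hkv⟩
    · obtain ⟨u, b, h1, h2, h3⟩ := exists_cycle_mul_le A hk.le v v
      refine ih (k - b) (by omega) (by omega) (le_antisymm ?_ (one_le_pow_apply_self h _ _))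
      rw [← hkv]
      exact (le_mul_of_one_le_left' (h u b h1 h2)).trans h3

theorem pow_apply_self_le_one {A : Matrix ι ι MaxPlus} {v : ι} (h : A v v ≤ 1) (k : ℕ) :
    (A ^ k) v v ≤ 1 := by
  induction k with
  | zero => simp
  | succ k ih =>
    rw [pow_succ]
    exact (mul_apply_le _ _ v v v).trans (mul_le_one' ih h)

/-! ### Critical and noncritical parts -/

section Projector

variable {D : Matrix ι ι MaxPlus}

theorem pow_add_apply_critical_le {c : ι} (hc : D c c = 1) (i : ι) (a b : ℕ) :
    (D ^ (a + b)) i c ≤ (D ^ a) i c := by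
  rw [pow_add]
  exact (mul_apply_le _ _ i c c).trans (mul_le_of_le_one_right' (pow_apply_self_le_one hc.le b))

/-- The cost of reaching a critical node `c` in `k` steps is least for `k = Fintype.card ι`: one can
wait at `c` for free, and cycles can be removed from longer walks. -/
theorem pow_card_apply_critical_le (h : ∀ v b, 1 ≤ b → b ≤ Fintype.card ι → 1 ≤ (D ^ b) v v)
    {c : ι} (hc : D c c = 1) (i : ι) (k : ℕ) : (D ^ Fintype.card ι) i c ≤ (D ^ k) i c := by
  induction k using Nat.strong_induction_on with
  | _ k ih =>
    rcases le_or_gt k (Fintype.card ι) with hk | hk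
    · obtain ⟨b, hb⟩ := Nat.exists_eq_add_of_le hk
      rw [hb]
      exact pow_add_apply_critical_le hc i k b
    · obtain ⟨u, b, h1, h2, h3⟩ := exists_cycle_mul_le D hk.le i c
      exact (ih (k - b) (by omega)).trans ((le_mul_of_one_le_left' (h u b h1 h2)).trans h3)

theorem pow_card_critical_apply_le (h : ∀ v b, 1 ≤ b → b ≤ Fintype.card ι → 1 ≤ (D ^ b) v v)
    {c : ι} (hc : D c c = 1) (j : ι) (k : ℕ) : (D ^ Fintype.card ι) c j ≤ (D ^ k) c j := by
  have := pow_card_apply_critical_le (D := D.transpose)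
    (fun v b h1 h2 => by simpa [← Matrix.transpose_pow] using h v b h1 h2) hc j k
  simpa [← Matrix.transpose_pow] using this

variable (D) in
/-- The matrix of least costs of long walks passing through a critical node, that is, a node `c` with
`D c c = 1`. With `N = Fintype.card ι`, such a walk costs `(D ^ N) i c` to reach `c` and
`(D ^ N) c j` to leave it. -/
noncomputable def criticalPart : Matrix ι ι MaxPlus := fun i j =>
  ∑ c with D c c = 1, (D ^ Fintype.card ι) i c * (D ^ Fintype.card ι) c j

variable (D) in
/-- The matrix `D` with the rows and columns of the critical nodes replaced by `ε`; its powers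
describe the walks that avoid critical nodes. -/
noncomputable def noncriticalPart : Matrix ι ι MaxPlus := fun i j =>
  if D i i = 1 ∨ D j j = 1 then 0 else D i j

theorem le_criticalPart_iff {t : MaxPlus} {i j : ι} :
    t ≤ criticalPart D i j ↔
      ∀ c, D c c = 1 → t ≤ (D ^ Fintype.card ι) i c * (D ^ Fintype.card ι) c j := by
  simp [criticalPart, le_sum_iff]

theorem criticalPart_le {c : ι} (hc : D c c = 1) (i j : ι) :
    criticalPart D i j ≤ (D ^ Fintype.card ι) i c * (D ^ Fintype.card ι) c j :=
  le_criticalPart_iff.1 le_rfl c hc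

theorem mul_criticalPart (h : ∀ v b, 1 ≤ b → b ≤ Fintype.card ι → 1 ≤ (D ^ b) v v) :
    D * criticalPart D = criticalPart D := by
  ext i j : 2
  have hcol : ∀ c, D c c = 1 → ∑ l, D i l * (D ^ Fintype.card ι) l c = (D ^ Fintype.card ι) i c :=
    fun c hc => by
      rw [← Matrix.mul_apply, ← pow_succ']
      exact le_antisymm (pow_add_apply_critical_le hc i _ 1) (pow_card_apply_critical_le h hc i _)
  simp only [Matrix.mul_apply, criticalPart, mul_sum]
  rw [sum_comm]
  refine sum_congr rfl fun c hc => ?_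
  rw [← hcol c (mem_filter.1 hc).2, sum_mul]
  exact sum_congr rfl fun l _ => (mul_assoc _ _ _).symm

theorem pow_mul_criticalPart (h : ∀ v b, 1 ≤ b → b ≤ Fintype.card ι → 1 ≤ (D ^ b) v v) (k : ℕ) :
    D ^ k * criticalPart D = criticalPart D := by
  induction k with
  | zero => simp
  | succ k ih => rw [pow_succ, mul_assoc, mul_criticalPart h, ih]

theorem pow_apply_mono {A B : Matrix ι ι MaxPlus} (h : ∀ i j, A i j ≤ B i j) (k : ℕ) (i j : ι) :
    (A ^ k) i j ≤ (B ^ k) i j := by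
  induction k generalizing j with
  | zero => simp
  | succ k ih =>
    rw [pow_succ, pow_succ]
    exact le_mul_apply_iff.2 fun l => (mul_apply_le _ _ i l j).trans (mul_le_mul' (ih l) (h l j))

omit [Fintype ι] [DecidableEq ι] in
theorem le_noncriticalPart (i j : ι) : D i j ≤ noncriticalPart D i j := by
  unfold noncriticalPart
  split_ifs
  exacts [Tropical.le_zero _, le_rfl]

/-- Every walk passes through a critical node, and then costs at least what `criticalPart` says, or
avoids all critical nodes. -/
theorem criticalPart_add_noncriticalPart_pow_le
    (h : ∀ v b, 1 ≤ b → b ≤ Fintype.card ι → 1 ≤ (D ^ b) v v) (k : ℕ) (i j : ι) :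
    criticalPart D i j + (noncriticalPart D ^ k) i j ≤ (D ^ k) i j := by
  induction k generalizing i with
  | zero => simpa using (le_add_iff.1 (le_refl (criticalPart D i j + (1 : Matrix ι ι _) i j))).2
  | succ k ih =>
    -- A walk visiting the critical node `c` after `a` steps costs at least `criticalPart D i j`.
    have key : ∀ {c}, D c c = 1 → ∀ a b, criticalPart D i j ≤ (D ^ a) i c * (D ^ b) c j :=
      fun hc a b => (criticalPart_le hc i j).trans <| mul_le_mul'
        (pow_card_apply_critical_le h hc i a) (pow_card_critical_apply_le h hc j b)
    by_cases hi : D i i = 1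
    · refine (le_add_iff.1 le_rfl).1.trans ((key hi 0 (k + 1)).trans ?_)
      simp
    obtain ⟨l, hl⟩ := exists_le_mul_apply D (D ^ k) i j
    rw [pow_succ' D]
    refine le_trans ?_ hl
    by_cases hl' : D l l = 1
    · refine (le_add_iff.1 le_rfl).1.trans ((key hl' 1 k).trans ?_)
      rw [pow_one]
    refine le_trans ?_ (mul_le_mul_right (ih l) _)
    rw [mul_add, pow_succ' (noncriticalPart D)]
    refine add_le_add ?_ ?_
    · nth_rw 1 [← mul_criticalPart h]
      exact mul_apply_le _ _ _ _ _
    · refine (mul_apply_le _ _ i l j).trans (le_of_eq ?_)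
      simp [noncriticalPart, hi, hl']

theorem pow_eq_criticalPart_add (h : ∀ v b, 1 ≤ b → b ≤ Fintype.card ι → 1 ≤ (D ^ b) v v) {k : ℕ}
    (hk : 2 * Fintype.card ι ≤ k) : D ^ k = criticalPart D + noncriticalPart D ^ k := by
  ext i j : 2
  refine le_antisymm (le_add_iff.2 ⟨le_criticalPart_iff.2 fun c hc => ?_,
    pow_apply_mono le_noncriticalPart k i j⟩) (criticalPart_add_noncriticalPart_pow_le h k i j)
  obtain ⟨r, rfl⟩ := Nat.exists_eq_add_of_le hk
  rw [show 2 * Fintype.card ι + r = Fintype.card ι + r + Fintype.card ι by ring, pow_add D (_ + r)]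
  exact (mul_apply_le _ _ i c j).trans (mul_le_mul_left (pow_add_apply_critical_le hc i _ r) _)

/-- Provided every node of a closed walk of cost `1` is critical, the cycles that avoid critical nodes
have negative weight. -/
theorem one_lt_noncriticalPart_pow (h : ∀ v b, 1 ≤ b → b ≤ Fintype.card ι → 1 ≤ (D ^ b) v v)
    (hcrit : ∀ v k, 1 ≤ k → (D ^ k) v v = 1 → D v v = 1) {v : ι} {b : ℕ} (hb : 1 ≤ b) :
    1 < (noncriticalPart D ^ b) v v := by
  by_cases hv : D v v = 1
  · obtain ⟨b, rfl⟩ := Nat.exists_eq_add_of_le' hb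
    have : (noncriticalPart D ^ (b + 1)) v v = 0 := by
      simp [pow_succ', Matrix.mul_apply, noncriticalPart, hv]
    exact this ▸ lt_zero_iff.2 one_ne_zero
  · exact (lt_of_le_of_ne (one_le_pow_apply_self h b v) fun h' => hv (hcrit v b hb h'.symm)).trans_le
      (pow_apply_mono le_noncriticalPart b v v)

omit [Fintype ι] [DecidableEq ι] in
/-- Uniqueness of limits: summands that tend to `ε` can be discarded from an equation. -/
theorem eq_of_add_eq_add {X Z : Matrix ι ι MaxPlus} {Y W : ℕ → Matrix ι ι MaxPlus} {K : ℕ}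
    (h : ∀ k ≥ K, X + Y k = Z + W k)
    (hYW : ∀ t : MaxPlus, t ≠ 0 → ∃ K, ∀ k ≥ K, ∀ i j, t < Y k i j ∧ t < W k i j) : X = Z := by
  ext i j : 2
  by_contra hne
  have ht : X i j + Z i j ≠ 0 := by
    intro h0
    obtain ⟨hx, hz⟩ := le_add_iff.1 h0.ge
    exact hne <| (le_antisymm (Tropical.le_zero (X i j)) hx).trans
      (le_antisymm (Tropical.le_zero (Z i j)) hz).symm
  obtain ⟨K', hK'⟩ := hYW _ ht
  obtain ⟨hy, hw⟩ := hK' (max K K') (le_max_right _ _) i j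
  have e : X i j + Y (max K K') i j = Z i j + W (max K K') i j :=
    congrFun₂ (h _ (le_max_left _ _)) i j
  rcases lt_or_gt_of_ne hne with hlt | hlt
  · rw [Tropical.add_eq_left hlt.le] at hy hw
    rw [Tropical.add_eq_left hy.le] at e
    exact (lt_min hlt hw).ne e
  · rw [Tropical.add_eq_right hlt.le] at hy hw
    rw [Tropical.add_eq_left hw.le] at e
    exact (lt_min hlt hy).ne e.symm

theorem commute_criticalPart (h : ∀ v b, 1 ≤ b → b ≤ Fintype.card ι → 1 ≤ (D ^ b) v v)
    (hcrit : ∀ v k, 1 ≤ k → (D ^ k) v v = 1 → D v v = 1) {B : Matrix ι ι MaxPlus}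
    (hB : Commute B D) : Commute B (criticalPart D) := by
  refine eq_of_add_eq_add (Y := fun k => B * noncriticalPart D ^ k)
    (W := fun k => noncriticalPart D ^ k * B) (K := 2 * Fintype.card ι) (fun k hk => ?_)
    fun t ht => exists_lt_mul_pow_apply _ B
      (fun v b h1 _ => one_lt_noncriticalPart_pow h hcrit h1) ht
  rw [← mul_add, ← add_mul, ← pow_eq_criticalPart_add h hk]
  exact hB.pow_right k

theorem criticalPart_mul_self (h : ∀ v b, 1 ≤ b → b ≤ Fintype.card ι → 1 ≤ (D ^ b) v v)
    (hcrit : ∀ v k, 1 ≤ k → (D ^ k) v v = 1 → D v v = 1) :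
    criticalPart D * criticalPart D = criticalPart D := by
  refine eq_of_add_eq_add (Y := fun k => noncriticalPart D ^ k * criticalPart D)
    (W := fun _ => 0) (K := 2 * Fintype.card ι) (fun k hk => ?_) fun t ht => ?_
  · rw [← add_mul, ← pow_eq_criticalPart_add h hk, pow_mul_criticalPart h, add_zero]
  · obtain ⟨K, hK⟩ := exists_lt_mul_pow_apply _ (criticalPart D)
      (fun v b h1 _ => one_lt_noncriticalPart_pow h hcrit h1) ht
    exact ⟨K, fun k hk i j => ⟨(hK k hk i j).2, lt_zero_iff.2 ht⟩⟩

end Projector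

/-! ### Common generalised eigenvectors -/

/-- The image of `Q` consists of generalised eigenvectors of `A`, for the maximal cycle mean of `A`,
and is invariant under every matrix that commutes with `A`. -/
theorem exists_spectral_projector {A : Matrix ι ι MaxPlus} (hA : A ^ Fintype.card ι ≠ 0) :
    ∃ (m : ℕ) (c : MaxPlus) (Q : Matrix ι ι MaxPlus), 1 ≤ m ∧ c ≠ 0 ∧ Q ≠ 0 ∧
      A ^ m * Q = c • Q ∧ IsIdempotentElem Q ∧ ∀ B, Commute B A → Commute B Q := by
  obtain ⟨r, hr, v₀, b₀, hb1, hb2, hb3⟩ := (exists_cycleMean A).resolve_left fun h0 => hA <| by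
    ext i j : 2
    obtain ⟨v, b, h1, h2, h3⟩ := exists_cycle_mul_le A le_rfl i j
    rw [h0 v b h1 h2, zero_mul] at h3
    exact le_antisymm (Tropical.le_zero _) h3
  have hinv : ofReal (-r) * ofReal r = 1 := by
    rw [ofReal_mul_ofReal, neg_add_cancel, ofReal_zero]
  -- `E` is `A` divided by its maximal cycle mean.
  obtain ⟨E, hE⟩ : ∃ E, E = ofReal (-r) • A := ⟨_, rfl⟩
  have hEpow : ∀ k, E ^ k = ofReal (-r) ^ k • A ^ k := fun k => by rw [hE, smul_pow]
  have hEA : ∀ k, A ^ k = ofReal r ^ k • E ^ k := fun k => by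
    rw [hEpow, smul_smul, ← mul_pow, mul_comm, hinv, one_pow, one_smul]
  have hE1 : ∀ v b, 1 ≤ b → b ≤ Fintype.card ι → 1 ≤ (E ^ b) v v := fun v b h1 h2 => by
    have := mul_le_mul_right (hr v b h1 h2) (ofReal (-r) ^ b)
    rw [← mul_pow, hinv, one_pow] at this
    rwa [hEpow]
  -- The length of a short critical cycle divides `(Fintype.card ι)!`, so going round it repeatedly
  -- gives a closed walk of that length and of cost `1`.
  have hdvd : ∀ v b, 1 ≤ b → b ≤ Fintype.card ι → (E ^ b) v v = 1 →
      (E ^ (Fintype.card ι).factorial) v v = 1 := fun v b h1 h2 h3 => by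
    obtain ⟨q, hq⟩ := Nat.dvd_factorial h1 h2
    refine le_antisymm ?_ (one_le_pow_apply_self hE1 _ _)
    rw [hq, pow_mul]
    exact pow_apply_self_le_one h3.le q
  have hm := Nat.factorial_pos (Fintype.card ι)
  have hD : ∀ v b, 1 ≤ b → b ≤ Fintype.card ι →
      1 ≤ ((E ^ (Fintype.card ι).factorial) ^ b) v v := fun v b _ _ => by
    rw [← pow_mul]
    exact one_le_pow_apply_self hE1 _ _
  have hcrit : ∀ v k, 1 ≤ k → ((E ^ (Fintype.card ι).factorial) ^ k) v v = 1 →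
      (E ^ (Fintype.card ι).factorial) v v = 1 := fun v k hk hv => by
    rw [← pow_mul] at hv
    obtain ⟨b, h1, h2, h3⟩ := exists_short_critical_cycle hE1 _ v (Nat.mul_pos hm hk) hv
    exact hdvd v b h1 h2 h3
  refine ⟨(Fintype.card ι).factorial, ofReal r ^ (Fintype.card ι).factorial,
    criticalPart (E ^ (Fintype.card ι).factorial), hm, pow_ne_zero _ (ofReal_ne_zero r),
    fun h0 => ?_, ?_, criticalPart_mul_self hD hcrit, fun B hB => ?_⟩
  · have hv : (E ^ (Fintype.card ι).factorial) v₀ v₀ = 1 := hdvd v₀ b₀ hb1 hb2 <| by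
      rw [hEpow, Matrix.smul_apply, hb3, smul_eq_mul, ← mul_pow, hinv, one_pow]
    have := (criticalPart_le hv v₀ v₀).trans (mul_le_one'
      (pow_apply_self_le_one hv.le _) (pow_apply_self_le_one hv.le _))
    rw [h0] at this
    exact ne_zero_of_le this one_ne_zero rfl
  · rw [hEA, Matrix.smul_mul, mul_criticalPart hD]
  · refine commute_criticalPart hD hcrit (Commute.pow_right ?_ _)
    rw [hE]
    exact hB.smul_right _

theorem exists_pow_eq (c : MaxPlus) {m : ℕ} (hm : 1 ≤ m) : ∃ l : MaxPlus, l ^ m = c := by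
  rcases eq_zero_or_eq_ofReal c with rfl | ⟨r, rfl⟩
  · exact ⟨0, zero_pow (by omega)⟩
  · have : (m : ℝ) ≠ 0 := by positivity
    exact ⟨ofReal (r / m), by rw [ofReal_pow, mul_div_cancel₀ r this]⟩

/-- The nonzero columns of `X` are common generalised eigenvectors of `A` and `B`. -/
theorem exists_common_eigenmatrix [Nonempty ι] {A B : Matrix ι ι MaxPlus} (hAB : Commute A B) :
    ∃ (X : Matrix ι ι MaxPlus) (m k : ℕ) (c d : MaxPlus), X ≠ 0 ∧ 1 ≤ m ∧ 1 ≤ k ∧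
      A ^ m * X = c • X ∧ B ^ k * X = d • X := by
  have hN : 1 ≤ Fintype.card ι := Fintype.card_pos
  by_cases hA : A ^ Fintype.card ι = 0
  · by_cases hB : B ^ Fintype.card ι = 0
    · exact ⟨1, _, _, 0, 0, one_ne_zero, hN, hN, by simp [hA], by simp [hB]⟩
    · obtain ⟨k, d, Q, hk, -, hQ, hBQ, -⟩ := exists_spectral_projector hB
      exact ⟨Q, _, k, 0, d, hQ, hN, hk, by simp [hA], hBQ⟩
  obtain ⟨m, c, Q, hm, -, hQ, hAQ, hQQ, hcomm⟩ := exists_spectral_projector hA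
  have hBQ : Commute B Q := hcomm B hAB.symm
  have hpow : ∀ k, 1 ≤ k → (B * Q) ^ k = B ^ k * Q := fun k hk => by
    rw [hBQ.mul_pow, hQQ.pow_eq (by omega)]
  by_cases hC : (B * Q) ^ Fintype.card ι = 0
  · exact ⟨Q, m, _, c, 0, hQ, hm, hN, hAQ, by rw [← hpow _ hN, hC, zero_smul]⟩
  obtain ⟨k, d, P, hk, hd, hP, hCP, -, -⟩ := exists_spectral_projector hC
  rw [hpow k hk] at hCP
  -- `d • P = (B * Q) ^ k * P` lies in the image of the idempotent `Q`, and `d` is invertible.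
  have hQP : Q * P = P := by
    have : d • (Q * P) = d • P := by
      rw [← Matrix.mul_smul, ← hCP, ← mul_assoc, ← mul_assoc, ← (hBQ.pow_left k).eq, mul_assoc _ Q Q,
        hQQ.eq]
    obtain ⟨r, rfl⟩ := (eq_zero_or_eq_ofReal d).resolve_left hd
    have := congrArg (ofReal (-r) • ·) this
    simpa only [smul_smul, ofReal_mul_ofReal, neg_add_cancel, ofReal_zero, one_smul] using this
  refine ⟨P, m, k, c, d, hP, hm, hk, ?_, ?_⟩
  · rw [← hQP, ← mul_assoc, hAQ, Matrix.smul_mul]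
  · rw [← hCP, mul_assoc, hQP]

theorem pow_mulVec_ne_zero {A : Matrix ι ι MaxPlus} (hA : ∀ j, ∃ i, A i j ≠ 0) {x : ι → MaxPlus}
    (hx : x ≠ 0) (m : ℕ) : (A ^ m).mulVec x ≠ 0 := by
  induction m with
  | zero => simpa using hx
  | succ m ih =>
    obtain ⟨j, hj⟩ := Function.ne_iff.1 ih
    obtain ⟨i, hi⟩ := hA j
    rw [pow_succ', ← Matrix.mulVec_mulVec]
    refine Function.ne_iff.2 ⟨i, ne_zero_of_le (sum_le (mem_univ j)) (mul_ne_zero hi hj)⟩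

theorem isGeneralisedEigenvector_of_pow {n : ℕ} {A : Matrix (Fin n) (Fin n) MaxPlus}
    {x : Fin n → MaxPlus} (hx : x ≠ 0) {m : ℕ} (hm : 1 ≤ m) {c : MaxPlus}
    (h : (A ^ m).mulVec x = c • x) :
    ∃ lam, IsGeneralisedEigenvector A lam x ∧ ((∀ j, ∃ i, A i j ≠ 0) → lam ≠ 0) := by
  obtain ⟨l, rfl⟩ := exists_pow_eq c hm
  refine ⟨l, ⟨hx, m, hm, h⟩, ?_⟩
  rintro hA rfl
  rw [zero_pow (by omega), zero_smul] at h
  exact pow_mulVec_ne_zero hA hx m h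

end MaxPlus

theorem mainTheorem8 (n : ℕ) (hn : 1 ≤ n) (A B : Matrix (Fin n) (Fin n) MaxPlus)
    (hAB : A * B = B * A) :
    ∃ (x : Fin n → MaxPlus) (lam mu : MaxPlus),
      MaxPlus.IsGeneralisedEigenvector A lam x ∧
      MaxPlus.IsGeneralisedEigenvector B mu x ∧
      ((∀ j, ∃ i, A i j ≠ 0) → lam ≠ 0) ∧
      ((∀ j, ∃ i, B i j ≠ 0) → mu ≠ 0) := by
  have : Nonempty (Fin n) := ⟨⟨0, hn⟩⟩
  obtain ⟨X, m, k, c, d, hX, hm, hk, hA, hB⟩ := MaxPlus.exists_common_eigenmatrix hAB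
  obtain ⟨j, hj⟩ : ∃ j, X.col j ≠ 0 := by
    by_contra! h
    exact hX (by ext i j : 2; exact congrFun (h j) i)
  obtain ⟨lam, hlam, hlam0⟩ := MaxPlus.isGeneralisedEigenvector_of_pow hj hm (c := c)
    (funext fun i => congrFun₂ hA i j)
  obtain ⟨mu, hmu, hmu0⟩ := MaxPlus.isGeneralisedEigenvector_of_pow hj hk (c := d)
    (funext fun i => congrFun₂ hB i j)
  exact ⟨X.col j, lam, mu, hlam, hmu, hlam0, hmu0⟩
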